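/- Write a permutation $\pi$ of $\{1,\dots,n\}$ as a word $\pi_1\pi_2\cdots\pi_n$. An index $i\in\{1,\dots,n-1\}$ is a left peak of $\pi$ if $\pi_i>\pi_{i+1}$ and either $i=1$ or $\pi_{i-1}<\pi_i$. Let $\operatorname{lpk}(\pi)$ be the number of left peaks of $\pi$ and $\operatorname{ilpk}(\pi)=\operatorname{lpk}(\pi^{-1})$. For $m\ge 2$ let $\operatorname{occ}_{12\cdots m}(\pi)$ be the number of occurrences of the consecutive pattern $12\cdots m$ in $\pi$, that is, the number of $i$ with $1\le i\le n-m+1$ and $\pi_i<\pi_{i+1}<\cdots<\pi_{i+m-1}$. For $n\ge 0$ put $$P^{\operatorname{ilpk}}_{12\cdots m,n}(s,t)=\sum_{\pi\in\mathfrak S_n}s^{\operatorname{occ}_{12\cdots m}(\pi)}t^{\operatorname{ilpk}(\pi)},\qquad P^{\operatorname{ilpk}}_{12\cdots m,n}(t)=P^{\operatorname{ilpk}}_{12\cdots m,n}(0,t)$$ (both equal to $1$ for $n=0$); the second polynomial gives the distribution of $\operatorname{ilpk}$ over the permutations with no occurrence of $12\cdots m$. For formal power series in $t$ whose coefficients are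 formal power series in $x$ (with coefficients in $\mathbb Q[s]$ or in $\mathbb Q$), the Hadamard product in $t$ is $\big(\sum_k a_kt^k\big)*\big(\sum_k b_kt^k\big)=\sum_k a_kb_kt^k$, and $f^{*\langle n\rangle}$ is the $n$-fold Hadamard product of $f$, with $f^{*\langle 0\rangle}=\sum_k t^k=1/(1-t)$. All other products are ordinary ones, and infinite sums are formal. **Theorem.** Let $m\ge 2$, $u=\dfrac{4t}{(1+t)^2}$ and $z=\dfrac{(1+t)x}{1-t}$. Then $$\text{(a)}\quad \frac1{1-t}\sum_{n=0}^\infty P^{\operatorname{ilpk}}_{12\cdots m,n}(s,u)\,z^n=\sum_{n=0}^\infty\left(\frac{z}{1-t}+\frac{(s-1)z^m}{(1-t)\big(1-(s-1)\sum_{l=1}^{m-1}z^l\big)}\right)^{*\langle n\rangle},$$ $$\text{(b)}\quad \frac1{1-t}\sum_{n=0}^\infty P^{\operatorname{ilpk}}_{12\cdots m,n}(u)\,z^n=\sum_{n=0}^\infty\left(\frac{z(1-z^{m-1})}{(1-t)(1-z^m)}\right)^{*\langle n\rangle},$$ $$\text{(c)}\quad \frac1{1-t}\sum_{n=0}^\infty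 P^{\operatorname{ilpk}}_{12\cdots m,n}(u)\,z^n=\sum_{k=0}^\infty\left[\sum_{j=0}^\infty\big(d_{m,j,k}x^{jm}-d'_{m,j,k}x^{jm+1}\big)\right]^{-1}t^k,$$ where $$d_{m,j,k}=\sum_{l=0}^k\binom{l+jm}{l}\binom{jm}{k-l},\qquad d'_{m,j,k}=\sum_{l=0}^k\binom{l+jm+1}{l}\binom{jm+1}{k-l}.$$ All fractions and the inverses in (c) exist, the denominators being invertible power series. -/

import Mathlib

open Polynomial PowerSeries

/-- Position `i` (positions are counted from `0`) is a descent of the word `π 0, π 1, …, π (n-1)`. -/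
def IsDescent {n : ℕ} (π : Equiv.Perm (Fin n)) (i : ℕ) : Prop :=
  ∃ h : i + 1 < n, π ⟨i + 1, h⟩ < π ⟨i, by omega⟩

/-- Position `i` is a peak: it has a left and a right neighbour, and both carry smaller letters. -/
def IsPeak {n : ℕ} (π : Equiv.Perm (Fin n)) (i : ℕ) : Prop :=
  ∃ h : 0 < i ∧ i + 1 < n,
    π ⟨i - 1, by omega⟩ < π ⟨i, by omega⟩ ∧ π ⟨i + 1, h.2⟩ < π ⟨i, by omega⟩

/-- A left peak is a peak, or the first position if that is a descent. -/
def IsLeftPeak {n : ℕ} (π : Equiv.Perm (Fin n)) (i : ℕ) : Prop :=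
  IsPeak π i ∨ (i = 0 ∧ IsDescent π i)

open Classical in
/-- The number of left peaks. -/
noncomputable def lpk {n : ℕ} (π : Equiv.Perm (Fin n)) : ℕ :=
  ((Finset.range n).filter (fun i => IsLeftPeak π i)).card

/-- The inverse left peak number. -/
noncomputable def ilpk {n : ℕ} (π : Equiv.Perm (Fin n)) : ℕ := lpk π⁻¹

/-- The `m` consecutive letters of `π` starting at position `i` exist and are in the same relative
order as the letters of `σ`. -/
def IsOccurrence {m n : ℕ} (σ : Equiv.Perm (Fin m)) (π : Equiv.Perm (Fin n)) (i : ℕ) : Prop :=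
  ∃ h : i + m ≤ n, ∀ a b : Fin m,
    π ⟨i + a, by omega⟩ < π ⟨i + b, by omega⟩ ↔ σ a < σ b

open Classical in
/-- The number of occurrences of `σ` in `π` as a consecutive pattern. -/
noncomputable def occ {m n : ℕ} (σ : Equiv.Perm (Fin m)) (π : Equiv.Perm (Fin n)) : ℕ :=
  ((Finset.range (n + 1)).filter (fun i => IsOccurrence σ π i)).card

/-- The polynomial `∑_π s^{occ_σ(π)} t^{ilpk(π)}` over all permutations `π` of length `n`, as a
polynomial in `t` whose coefficients are polynomials in `s`. -/
noncomputable def ilpkPoly {m : ℕ} (σ : Equiv.Perm (Fin m)) (n : ℕ) : ℚ[X][X] :=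
  ∑ π : Equiv.Perm (Fin n), Polynomial.C (Polynomial.X ^ occ σ π) * Polynomial.X ^ ilpk π

/-- The previous polynomial at `s = 0`, a polynomial in `t`. -/
noncomputable def ilpkPolyAvoid {m : ℕ} (σ : Equiv.Perm (Fin m)) (n : ℕ) : ℚ[X] :=
  (ilpkPoly σ n).map (Polynomial.evalRingHom 0)

/-- Formal power series in `x` and `t` over `R`, arranged as series in `t` (the outer variable)
whose coefficients are series in `x` (the inner variable). -/
abbrev SeriesTX (R : Type) [CommRing R] : Type := R⟦X⟧⟦X⟧

namespace SeriesTX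

variable {R : Type} [CommRing R]

/-- The variable `t`. -/
noncomputable def t : SeriesTX R := PowerSeries.X

/-- The variable `x`. -/
noncomputable def x : SeriesTX R := PowerSeries.C PowerSeries.X

/-- Scalars as constant series in `x` and `t`. -/
noncomputable def scalar : R →+* SeriesTX R :=
  (PowerSeries.C (R := R⟦X⟧)).comp (PowerSeries.C (R := R))

/-- The fraction `a / b`, meaningful when `b` is a unit. -/
noncomputable def frac {A : Type} [CommRing A] (a b : A) : A := a * Ring.inverse b

/-- `u = 4t / (1+t)^2`. -/
noncomputable def u : SeriesTX R := frac (4 * t) ((1 + t) ^ 2)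

/-- `z = (1+t)x / (1-t)`. -/
noncomputable def z : SeriesTX R := frac ((1 + t) * x) (1 - t)

/-- The value `p(a)` of a polynomial with scalar coefficients at a series. -/
noncomputable def evalAt (p : R[X]) (a : SeriesTX R) : SeriesTX R := p.eval₂ scalar a

/-- The Hadamard product in `t`: it multiplies coefficients of equal powers of `t`, and is the
ordinary product in `x`. -/
noncomputable def hadamard (f g : SeriesTX R) : SeriesTX R :=
  PowerSeries.mk fun k => PowerSeries.coeff k f * PowerSeries.coeff k g

/-- The `n`-fold Hadamard product; the empty product is the identity `1 + t + t^2 + ⋯`. -/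
noncomputable def hadamardPow (f : SeriesTX R) : ℕ → SeriesTX R
  | 0 => PowerSeries.mk fun _ => 1
  | n + 1 => hadamard (hadamardPow f n) f

end SeriesTX

/-- `g` is the formal sum `∑_n f n` of series in `x`: each coefficient receives only finitely many
nonzero contributions, and these add up to the coefficient of `g`. -/
def HasFormalSumX {R : Type} [CommRing R] (f : ℕ → R⟦X⟧) (g : R⟦X⟧) : Prop :=
  ∀ i, (Function.support fun n => PowerSeries.coeff i (f n)).Finite ∧
    ∑ᶠ n, PowerSeries.coeff i (f n) = PowerSeries.coeff i g

/-- `g` is the formal sum `∑_n f n` of series in `x` and `t`, coefficient by coefficient. -/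
def HasFormalSumTX {R : Type} [CommRing R] (f : ℕ → SeriesTX R) (g : SeriesTX R) : Prop :=
  ∀ k, HasFormalSumX (fun n => PowerSeries.coeff k (f n)) (PowerSeries.coeff k g)

/-- The numbers `d_{m,j,k}`. -/
def dCoeff (m j k : ℕ) : ℕ :=
  ∑ l ∈ Finset.range (k + 1), (l + j * m).choose l * (j * m).choose (k - l)

/-- The numbers `d'_{m,j,k}`. -/
def dCoeff' (m j k : ℕ) : ℕ :=
  ∑ l ∈ Finset.range (k + 1), (l + j * m + 1).choose l * (j * m + 1).choose (k - l)

/-! Fix `k` and compare the coefficients of `t^k`. Let `d` record the descents of `π⁻¹`. In the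
manner of enriched `P`-partitions, `[t^k] u^ilpk(π) (1/(1-t)) ((1+t)/(1-t))^n` counts the weakly
increasing sequences over `0, …, 2k` of length `n` in which equal neighbours are odd at a descent
and even at an ascent (`sum_compatible_eq_coeff`). The proof is a recursion in `n` that separates
even and odd last letters: each letter contributes `(1+t)/(1-t)`, and each left peak an extra `u`.

A pair of a permutation `π` and a sequence compatible with `π⁻¹` is the same as an arbitrary word
`w`, with `π` its standardization when ties are read from left to right for even letters and from
right to left for odd ones. Ascents of `π` are then the steps of `w` that go up, or stay at an even
letter. So the sum over `π` becomes a sum over words weighted by `s^occ` (`sum_perm_eq_sum_word`).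

Such words fall into increasing runs, and a run of length `r` holds `max(r+1-m, 0)` occurrences. If
`γ` is the reciprocal of the series of run weights and `h_j` is the number of increasing words of
length `j`, the words are counted by `1 / ∑ γ_j h_j x^j` (`run_theorem`). Since `h_j = [t^k]
(1/(1-t)) ((1+t)/(1-t))^j`, the denominator is `1 - f_k`, with `f_k` the coefficient of `t^k` in the
fraction of (a). Hadamard powers act on each `f_k` separately, so the geometric series gives (a). At
`s = 0` one has `γ = (1-y)/(1-y^m)`, which yields (b) and, read off coefficientwise, (c). -/

/-! ### Compatible sequences and their recursion -/

/-- The relation between consecutive letters of a compatible sequence: letters increase weakly,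
and equal letters are odd at a descent and even at an ascent. -/
def LetterStep (d : Prop) (a b : ℕ) : Prop := a < b ∨ (a = b ∧ (Odd a ↔ d))

/-- The sequence `f` respects the descent data `d`, where `d (i + 1)` belongs to the step from
position `i` to position `i + 1`. -/
def Compatible {n K : ℕ} (d : ℕ → Prop) (f : Fin n → Fin K) : Prop :=
  ∀ i, ∀ h : i + 1 < n, LetterStep (d (i + 1)) (f ⟨i, by omega⟩) (f ⟨i + 1, h⟩)

open Classical in
/-- The number of compatible sequences of length `n` with a given last letter. -/
noncomputable def chainCount (d : ℕ → Prop) : ℕ → ℕ → ℕ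
  | 0, b => if b = 0 then 1 else 0
  | n + 1, b => ∑ a ∈ Finset.range (b + 1), if LetterStep (d n) a b then chainCount d n a else 0

lemma compatible_snoc {n K : ℕ} (d : ℕ → Prop) (g : Fin (n + 1) → Fin K) (a : Fin K) :
    Compatible d (Fin.snoc (α := fun _ => Fin K) g a) ↔
      Compatible d g ∧ LetterStep (d (n + 1)) (g (Fin.last n)) a := by
  have key : ∀ i (h : i < n + 1) (h' : i < n + 2),
      (Fin.snoc (α := fun _ => Fin K) g a : Fin (n + 2) → Fin K) ⟨i, h'⟩ = g ⟨i, h⟩ := by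
    intro i h h'
    exact Fin.snoc_castSucc (α := fun _ => Fin K) a g ⟨i, h⟩
  have keyl : ∀ (h' : n + 1 < n + 2),
      (Fin.snoc (α := fun _ => Fin K) g a : Fin (n + 2) → Fin K) ⟨n + 1, h'⟩ = a := by
    intro h'
    exact Fin.snoc_last (α := fun _ => Fin K) a g
  constructor
  · intro H
    refine ⟨fun i h => ?_, ?_⟩
    · have := H i (by omega)
      rwa [key i (by omega), key (i + 1) h] at this
    · have := H n (by omega)
      rwa [key n (by omega), keyl] at this
  · rintro ⟨H, H'⟩ i h
    rcases Nat.lt_or_ge (i + 1) (n + 1) with h1 | h1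
    · rw [key i (by omega), key (i + 1) h1]
      exact H i h1
    · obtain rfl : i = n := by omega
      rw [key i (by omega), keyl]
      exact H'

-- The last letter is all that a further step needs to know, so deleting it gives the recursion. By
-- `hd`, the step from the fictitious letter `0` before the word imposes no condition, even on a
-- first letter `0`.
open Classical in
lemma sum_compatible_last {K : ℕ} (d : ℕ → Prop) (hd : ¬ d 0) (n : ℕ) (b : Fin K) :
    (∑ f : Fin (n + 1) → Fin K, if Compatible d f ∧ f (Fin.last n) = b then 1 else 0) =
      chainCount d (n + 1) b := by
  induction n generalizing b with
  | zero =>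
    rw [← (Equiv.funUnique (Fin 1) (Fin K)).symm.sum_comp]
    have h1 : ∀ f : Fin (0 + 1) → Fin K, Compatible d f := fun f i h => by omega
    have h2 : chainCount d (0 + 1) b = 1 := by
      rw [chainCount, Finset.sum_eq_single 0]
      · have : LetterStep (d 0) 0 b := by
          rcases Nat.eq_zero_or_pos (b : ℕ) with h | h
          · exact Or.inr ⟨h.symm, by simpa using hd⟩
          · exact Or.inl h
        simp [this, chainCount]
      · intro a _ ha
        simp [chainCount, ha]
      · simp
    rw [h2]
    simp [h1]
  | succ n ih =>
    rw [← (Fin.snocEquiv (fun _ : Fin (n + 2) => Fin K)).sum_comp, Fintype.sum_prod_type]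
    have h1 : ∀ (a : Fin K) (g : Fin (n + 1) → Fin K),
        (if Compatible d (Fin.snocEquiv (fun _ : Fin (n + 2) => Fin K) (a, g)) ∧
          (Fin.snocEquiv (fun _ : Fin (n + 2) => Fin K) (a, g)) (Fin.last (n + 1)) = b
          then 1 else 0) =
        if a = b then (if Compatible d g ∧ LetterStep (d (n + 1)) (g (Fin.last n)) a
          then 1 else 0) else 0 := by
      intro a g
      have e : (Fin.snocEquiv (fun _ : Fin (n + 2) => Fin K) (a, g)) =
        Fin.snoc (α := fun _ => Fin K) g a := rfl
      rw [e, compatible_snoc, Fin.snoc_last]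
      by_cases h : a = b <;> simp [h]
    simp_rw [h1]
    rw [Finset.sum_eq_single b (by intro a _ ha; simp [ha]) (by simp)]
    simp only [if_true]
    have h2 : ∀ g : Fin (n + 1) → Fin K,
        (if Compatible d g ∧ LetterStep (d (n + 1)) (g (Fin.last n)) b then 1 else 0) =
        ∑ a : Fin K, if LetterStep (d (n + 1)) a b then
          (if Compatible d g ∧ g (Fin.last n) = a then 1 else 0) else 0 := by
      intro g
      rw [Finset.sum_eq_single (g (Fin.last n))]
      · by_cases h : Compatible d g <;> simp [h]
      · intro a _ ha
        simp [ha.symm]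
      · simp
    simp_rw [h2]
    rw [Finset.sum_comm]
    have h3 : ∀ a : Fin K, (∑ g : Fin (n + 1) → Fin K, if LetterStep (d (n + 1)) a b then
          (if Compatible d g ∧ g (Fin.last n) = a then 1 else 0) else 0) =
          if LetterStep (d (n + 1)) a b then chainCount d (n + 1) a else 0 := by
      intro a
      by_cases h : LetterStep (d (n + 1)) a b
      · simp only [h, if_true]
        exact ih a
      · simp [h]
    rw [Finset.sum_congr rfl fun a _ => h3 a,
      Fin.sum_univ_eq_sum_range
        (fun a => if LetterStep (d (n + 1)) a b then chainCount d (n + 1) a else 0) K,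
      chainCount]
    symm
    apply Finset.sum_subset
    · intro a
      have := b.2
      simp only [Finset.mem_range]
      omega
    · intro a _ ha
      rw [if_neg]
      rintro (h | h) <;> simp only [Finset.mem_range] at ha <;> omega

open Classical in
/-- The number of compatible sequences of length `n` over the letters `0, …, 2k`. -/
lemma sum_compatible (d : ℕ → Prop) (hd : ¬ d 0) (n k : ℕ) :
    (∑ f : Fin n → Fin (2 * k + 1), if Compatible d f then 1 else 0) =
      ∑ b ∈ Finset.range (2 * k + 1), chainCount d n b := by
  cases n with
  | zero =>
    have h1 : ∀ f : Fin 0 → Fin (2 * k + 1), Compatible d f := fun f i h => by omega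
    simp [h1, chainCount]
  | succ n =>
    rw [← Fin.sum_univ_eq_sum_range (chainCount d (n + 1)) (2 * k + 1)]
    simp_rw [← sum_compatible_last d hd n]
    rw [Finset.sum_comm]
    refine Finset.sum_congr rfl fun f _ => ?_
    rw [Finset.sum_eq_single (f (Fin.last n))]
    · simp
    · intro a _ ha
      simp [ha.symm]
    · simp

/-! ### Fractions and generating functions in `t` -/

namespace SeriesTX

section Frac

variable {A B : Type} [CommRing A] [CommRing B]

lemma frac_mul_cancel {a b : A} (hb : IsUnit b) : frac a b * b = a := by
  rw [frac, mul_assoc, Ring.inverse_mul_cancel b hb, mul_one]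

lemma frac_eq_of_mul_eq {a b c : A} (hb : IsUnit b) (h : c * b = a) : frac a b = c := by
  rw [frac, ← h, mul_assoc, Ring.mul_inverse_cancel b hb, mul_one]

lemma map_frac (φ : A →+* B) {a b : A} (hb : IsUnit b) : φ (frac a b) = frac (φ a) (φ b) := by
  symm
  apply frac_eq_of_mul_eq (hb.map φ)
  rw [← map_mul, frac_mul_cancel hb]

end Frac

end SeriesTX

open SeriesTX

section Univariate

variable (R : Type) [CommRing R]

lemma isUnit_one_sub_X : IsUnit (1 - PowerSeries.X : R⟦X⟧) := by
  simp [PowerSeries.isUnit_iff_constantCoeff]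

lemma isUnit_one_add_X : IsUnit (1 + PowerSeries.X : R⟦X⟧) := by
  simp [PowerSeries.isUnit_iff_constantCoeff]

/-- The series `(1+t)/(1-t)`. -/
noncomputable def zT : R⟦X⟧ := frac (1 + PowerSeries.X) (1 - PowerSeries.X)

/-- The series `4t/(1+t)^2`. -/
noncomputable def uT : R⟦X⟧ := frac (4 * PowerSeries.X) ((1 + PowerSeries.X) ^ 2)

/-- The series `1/(1-t)`. -/
noncomputable def geomT : R⟦X⟧ := frac 1 (1 - PowerSeries.X)

lemma zT_mul : zT R * (1 - PowerSeries.X) = 1 + PowerSeries.X :=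
  frac_mul_cancel (isUnit_one_sub_X R)

lemma uT_mul : uT R * (1 + PowerSeries.X) ^ 2 = 4 * PowerSeries.X :=
  frac_mul_cancel ((isUnit_one_add_X R).pow 2)

lemma geomT_mul : geomT R * (1 - PowerSeries.X) = 1 :=
  frac_mul_cancel (isUnit_one_sub_X R)

/-- The generating function of the number of compatible sequences over `0, …, 2k`. -/
noncomputable def totalSeries (d : ℕ → Prop) (n : ℕ) : R⟦X⟧ :=
  PowerSeries.mk fun k => ((∑ b ∈ Finset.range (2 * k + 1), chainCount d n b : ℕ) : R)

/-- The generating function of the compatible sequences with even last letter. -/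
noncomputable def evenSeries (d : ℕ → Prop) (n : ℕ) : R⟦X⟧ :=
  PowerSeries.mk fun k => (chainCount d n (2 * k) : R)

/-- The generating function of the compatible sequences with odd last letter. -/
noncomputable def oddSeries (d : ℕ → Prop) (n : ℕ) : R⟦X⟧ :=
  PowerSeries.mk fun k => (chainCount d n (2 * k + 1) : R)

/-- Passing from `k` to `k + 1` adds one odd letter `2k+1` and one even letter `2k+2`. -/
lemma totalSeries_eq (d : ℕ → Prop) (n : ℕ) :
    totalSeries R d n = PowerSeries.X * totalSeries R d n + evenSeries R d n +
      PowerSeries.X * oddSeries R d n := by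
  ext k
  cases k with
  | zero => simp [totalSeries, evenSeries]
  | succ k =>
    simp only [totalSeries, evenSeries, oddSeries, map_add, PowerSeries.coeff_succ_X_mul,
      PowerSeries.coeff_mk]
    rw [show 2 * (k + 1) + 1 = 2 * k + 1 + 1 + 1 by ring, Finset.sum_range_succ,
      Finset.sum_range_succ, show 2 * (k + 1) = 2 * k + 1 + 1 by ring]
    push_cast
    ring

open Classical in
lemma chainCount_succ_of_step (d : ℕ → Prop) (n b : ℕ) (h : Odd b ↔ d n) :
    chainCount d (n + 1) b = ∑ a ∈ Finset.range (b + 1), chainCount d n a := by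
  rw [chainCount]
  refine Finset.sum_congr rfl fun a ha => if_pos ?_
  rcases Nat.lt_or_ge a b with h1 | h1
  · exact Or.inl h1
  · obtain rfl : a = b := by simp only [Finset.mem_range] at ha; omega
    exact Or.inr ⟨rfl, h⟩

open Classical in
lemma chainCount_succ_of_not_step (d : ℕ → Prop) (n b : ℕ) (h : ¬ (Odd b ↔ d n)) :
    chainCount d (n + 1) b = ∑ a ∈ Finset.range b, chainCount d n a := by
  rw [chainCount, Finset.sum_range_succ, if_neg, add_zero]
  · refine Finset.sum_congr rfl fun a ha => if_pos (Or.inl (Finset.mem_range.1 ha))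
  · rintro (h1 | h1)
    · omega
    · exact h h1.2

lemma evenSeries_succ_of_not (d : ℕ → Prop) (n : ℕ) (h : ¬ d n) :
    evenSeries R d (n + 1) = totalSeries R d n := by
  ext k
  simp only [evenSeries, totalSeries, PowerSeries.coeff_mk]
  rw [chainCount_succ_of_step d n _ (by simp [h])]

lemma oddSeries_succ_of_not (d : ℕ → Prop) (n : ℕ) (h : ¬ d n) :
    oddSeries R d (n + 1) = totalSeries R d n := by
  ext k
  simp only [oddSeries, totalSeries, PowerSeries.coeff_mk]
  rw [chainCount_succ_of_not_step d n _ (by simp [h])]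

lemma evenSeries_succ (d : ℕ → Prop) (n : ℕ) (h : d n) :
    evenSeries R d (n + 1) = totalSeries R d n - evenSeries R d n := by
  ext k
  simp only [evenSeries, totalSeries, PowerSeries.coeff_mk, map_sub]
  rw [chainCount_succ_of_not_step d n _ (by simp [h]), Finset.sum_range_succ]
  push_cast
  ring

lemma oddSeries_succ (d : ℕ → Prop) (n : ℕ) (h : d n) :
    oddSeries R d (n + 1) = totalSeries R d n + oddSeries R d n := by
  ext k
  simp only [oddSeries, totalSeries, PowerSeries.coeff_mk, map_add]
  rw [chainCount_succ_of_step d n _ (by simp [h]), Finset.sum_range_succ]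
  push_cast
  ring

lemma totalSeries_zero (d : ℕ → Prop) : totalSeries R d 0 = geomT R := by
  symm
  apply frac_eq_of_mul_eq (isUnit_one_sub_X R)
  have : totalSeries R d 0 = PowerSeries.mk 1 := by
    ext k
    simp [totalSeries, chainCount]
  rw [this, PowerSeries.mk_one_mul_one_sub_eq_one]

lemma totalSeries_succ_of_not (d : ℕ → Prop) (n : ℕ) (h : ¬ d n) :
    totalSeries R d (n + 1) = zT R * totalSeries R d n := by
  apply (isUnit_one_sub_X R).mul_left_injective
  have h1 := totalSeries_eq R d (n + 1)
  rw [evenSeries_succ_of_not R d n h, oddSeries_succ_of_not R d n h] at h1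
  linear_combination h1 - totalSeries R d n * zT_mul R

/-- After the ascent both parity series equal `T_n`. This gives `(1-t) T_{n+2} = 2t (T_{n+1} +
T_n)`, and `(1+t) T_n = (1-t) T_{n+1}` eliminates `T_n`. -/
lemma totalSeries_succ_succ_of_peak (d : ℕ → Prop) (n : ℕ) (h : ¬ d n) (h' : d (n + 1)) :
    totalSeries R d (n + 2) = zT R * uT R * totalSeries R d (n + 1) := by
  apply ((isUnit_one_sub_X R).mul ((isUnit_one_add_X R).pow 2)).mul_left_injective
  have h1 := totalSeries_eq R d (n + 2)
  have h2 := totalSeries_eq R d (n + 1)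
  rw [evenSeries_succ R d (n + 1) h', oddSeries_succ R d (n + 1) h'] at h1
  rw [evenSeries_succ_of_not R d n h, oddSeries_succ_of_not R d n h] at h1 h2
  have h3 := zT_mul R
  have h4 := uT_mul R
  set T := totalSeries R d n
  set T1 := totalSeries R d (n + 1)
  set T2 := totalSeries R d (n + 2)
  simp only
  have e1 : T2 * (1 - PowerSeries.X) = 2 * PowerSeries.X * (T1 + T) := by
    linear_combination h1 + h2
  have e2 : (1 + PowerSeries.X) * T = (1 - PowerSeries.X) * T1 := by linear_combination - h2
  linear_combination (1 + PowerSeries.X) ^ 2 * e1 - uT R * T1 * (1 + PowerSeries.X) ^ 2 * h3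
    - (1 + PowerSeries.X) * T1 * h4 + 2 * PowerSeries.X * (1 + PowerSeries.X) * e2

/-- The terms that deviate from `(1+t) T_{n+1}` are `(1-t) T_n - E_n - t O_n`, which vanishes by
`totalSeries_eq`. -/
lemma totalSeries_succ_succ_of_descents (d : ℕ → Prop) (n : ℕ) (h : d n) (h' : d (n + 1)) :
    totalSeries R d (n + 2) = zT R * totalSeries R d (n + 1) := by
  apply (isUnit_one_sub_X R).mul_left_injective
  have h1 := totalSeries_eq R d (n + 2)
  have h0 := totalSeries_eq R d n
  rw [evenSeries_succ R d (n + 1) h', oddSeries_succ R d (n + 1) h'] at h1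
  rw [evenSeries_succ R d n h, oddSeries_succ R d n h] at h1
  have h3 := zT_mul R
  linear_combination h1 - totalSeries R d (n + 1) * h3 - h0

open Classical in
lemma totalSeries_formula (d : ℕ → Prop) (hd : ¬ d 0) (n : ℕ) :
    totalSeries R d n = geomT R *
      (uT R ^ ((Finset.range (n - 1)).filter fun i => ¬ d i ∧ d (i + 1)).card * zT R ^ n) := by
  induction n with
  | zero => simp [totalSeries_zero]
  | succ n ih =>
    cases n with
    | zero => rw [totalSeries_succ_of_not R d 0 hd, ih]; simp; ring
    | succ n =>
      rw [show n + 1 + 1 - 1 = n + 1 by omega, Finset.range_add_one, Finset.filter_insert]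
      rw [show n + 1 - 1 = n by omega] at ih
      by_cases h' : d (n + 1)
      · by_cases h : d n
        · rw [totalSeries_succ_succ_of_descents R d n h h', ih, if_neg (by simp [h])]
          ring
        · rw [totalSeries_succ_succ_of_peak R d n h h', ih, if_pos ⟨h, h'⟩,
            Finset.card_insert_of_notMem (by simp)]
          ring
      · rw [totalSeries_succ_of_not R d (n + 1) h', ih, if_neg (by simp [h'])]
        ring

open Classical in
/-- The number of sequences over `0, …, 2k` that respect the descent data `d`. -/
theorem sum_compatible_eq_coeff (d : ℕ → Prop) (hd : ¬ d 0) (n k : ℕ) :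
    (∑ f : Fin n → Fin (2 * k + 1), if Compatible d f then (1 : R) else 0) =
      PowerSeries.coeff k (geomT R *
        (uT R ^ ((Finset.range (n - 1)).filter fun i => ¬ d i ∧ d (i + 1)).card * zT R ^ n)) := by
  rw [← totalSeries_formula R d hd n, totalSeries, PowerSeries.coeff_mk, ← sum_compatible d hd n k]
  push_cast
  rfl

end Univariate

/-! ### Standardization: from permutations to words -/

/-- The descent data of a permutation, shifted by one, with an ascent before the first letter. -/
def descentData {n : ℕ} (σ : Equiv.Perm (Fin n)) : ℕ → Prop
  | 0 => False
  | i + 1 => IsDescent σ i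

-- The fictitious initial ascent turns a descent in first position into an ascent followed by a
-- descent, like any other peak.
open Classical in
lemma lpk_eq {n : ℕ} (σ : Equiv.Perm (Fin n)) :
    lpk σ = ((Finset.range (n - 1)).filter fun i =>
      ¬ descentData σ i ∧ descentData σ (i + 1)).card := by
  unfold lpk
  congr 1
  ext i
  simp only [Finset.mem_filter, Finset.mem_range]
  cases i with
  | zero =>
    simp only [IsLeftPeak, IsPeak, IsDescent, descentData, lt_irrefl, false_and, IsEmpty.exists_iff,
      true_and, false_or, not_false_eq_true]
    constructor
    · rintro ⟨h, h', h''⟩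
      exact ⟨by omega, h', h''⟩
    · rintro ⟨h, h', h''⟩
      exact ⟨by omega, h', h''⟩
  | succ i =>
    simp only [IsLeftPeak, IsPeak, IsDescent, descentData, Nat.succ_ne_zero, false_and, or_false,
      Nat.add_sub_cancel, not_exists, not_lt]
    constructor
    · rintro ⟨h, ⟨h', h''⟩, h1, h2⟩
      exact ⟨by omega, fun _ => h1.le, h'', h2⟩
    · rintro ⟨h, h1, h', h2⟩
      refine ⟨by omega, ⟨by omega, h'⟩, lt_of_le_of_ne (h1 (by omega)) ?_, h2⟩
      intro e
      have := σ.injective e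
      simp at this

/-- The key that breaks ties between equal letters of a word: from left to right for even letters,
from right to left for odd ones. -/
noncomputable def standardKey {n K : ℕ} (w : Fin n → Fin K) (j : Fin n) : ℕ ×ₗ ℤ :=
  open Classical in toLex ((w j : ℕ), if Odd (w j : ℕ) then -(j : ℤ) else (j : ℤ))

lemma standardKey_injective {n K : ℕ} (w : Fin n → Fin K) :
    Function.Injective (standardKey w) := by
  intro i j h
  simp only [standardKey, EmbeddingLike.apply_eq_iff_eq, Prod.mk.injEq] at h
  obtain ⟨h1, h2⟩ := h
  rw [h1] at h2
  ext
  split_ifs at h2 <;> omega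

lemma standardKey_lt_iff {n K : ℕ} (w : Fin n → Fin K) {i j : Fin n} (hij : i ≠ j) :
    standardKey w i < standardKey w j ↔ LetterStep (j < i) (w i) (w j) := by
  have hij' : (i : ℕ) ≠ j := fun h => hij (Fin.ext h)
  rw [standardKey, standardKey, Prod.Lex.toLex_lt_toLex, LetterStep]
  refine or_congr Iff.rfl (and_congr_right fun h => ?_)
  simp only at h
  rw [h, Fin.lt_def]
  split_ifs with h'
  · simp only [h', true_iff]
    omega
  · simp only [h', false_iff]
    omega

/-- A step between neighbours is a strict inequality of keys, and keys are linearly ordered, so the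
local conditions chain together. -/
lemma compatible_iff_strictMono {n K : ℕ} (w : Fin n → Fin K) (σ : Equiv.Perm (Fin n)) :
    Compatible (descentData σ) (w ∘ σ) ↔ StrictMono (standardKey w ∘ σ) := by
  have key : ∀ i (h : i + 1 < n),
      (standardKey w (σ ⟨i, by omega⟩) < standardKey w (σ ⟨i + 1, h⟩) ↔
      LetterStep (descentData σ (i + 1)) ((w ∘ σ) ⟨i, by omega⟩) ((w ∘ σ) ⟨i + 1, h⟩)) := by
    intro i h
    rw [standardKey_lt_iff w (by simp)]
    simp [descentData, IsDescent, h]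
  cases n with
  | zero => exact ⟨fun _ i => i.elim0, fun _ i h => by omega⟩
  | succ n =>
    rw [Fin.strictMono_iff_lt_succ]
    constructor
    · intro H i
      exact (key i (by omega)).2 (H i (by omega))
    · intro H i h
      exact (key i h).1 (H ⟨i, by omega⟩)

/-- The keys are pairwise distinct, so exactly one arrangement sorts them. -/
lemma existsUnique_standardization {n K : ℕ} (w : Fin n → Fin K) :
    ∃ π : Equiv.Perm (Fin n), ∀ τ : Equiv.Perm (Fin n),
      StrictMono (standardKey w ∘ (τ⁻¹ : Equiv.Perm (Fin n))) ↔ τ = π := by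
  have hs : StrictMono (standardKey w ∘ Tuple.sort (standardKey w)) :=
    (Tuple.monotone_sort _).strictMono_of_injective
      ((standardKey_injective w).comp (Equiv.injective _))
  refine ⟨(Tuple.sort (standardKey w))⁻¹, fun τ => ⟨fun h => ?_, ?_⟩⟩
  · have := Tuple.unique_monotone h.monotone hs.monotone
    have h2 : τ⁻¹ = Tuple.sort (standardKey w) :=
      Equiv.ext fun i => standardKey_injective w (congrFun this i)
    rw [← h2, inv_inv]
  · rintro rfl
    simpa using hs

/-- The number of occurrences of `12⋯m` among the first `p` letters of a word with ascent set
`asc`. -/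
noncomputable def ascOcc (m : ℕ) (asc : ℕ → Prop) (p : ℕ) : ℕ :=
  open Classical in
  ((Finset.range (p + 1)).filter fun i => i + m ≤ p ∧ ∀ a, a + 1 < m → asc (i + a)).card

/-- The ascent set of a word whose letters are compared by `LetterStep False`. -/
def wordAsc {n K : ℕ} (w : Fin n → Fin K) (i : ℕ) : Prop :=
  ∃ h : i + 1 < n, LetterStep False (w ⟨i, by omega⟩) (w ⟨i + 1, h⟩)

lemma occ_one_eq_ascOcc {m n : ℕ} (π : Equiv.Perm (Fin n)) :
    occ (1 : Equiv.Perm (Fin m)) π =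
      ascOcc m (fun i => ∃ h : i + 1 < n, π ⟨i, by omega⟩ < π ⟨i + 1, h⟩) n := by
  unfold occ ascOcc
  congr 1
  ext i
  simp only [Finset.mem_filter, Finset.mem_range, and_congr_right_iff]
  intro _
  constructor
  · rintro ⟨h, H⟩
    refine ⟨h, fun a ha => ⟨by omega, ?_⟩⟩
    have := (H ⟨a, by omega⟩ ⟨a + 1, ha⟩).2 (by simp [Fin.lt_def])
    exact this
  · rintro ⟨h, H⟩
    refine ⟨h, ?_⟩
    have hmono : StrictMono fun a : Fin m => π ⟨i + a, by omega⟩ := by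
      cases m with
      | zero => exact fun a => a.elim0
      | succ m =>
        rw [Fin.strictMono_iff_lt_succ]
        intro a
        obtain ⟨h1, h2⟩ := H a (by omega)
        exact h2
    intro a b
    exact hmono.lt_iff_lt

/-- `π` ranks the positions by their keys, and between the neighbours `i` and `i + 1` a tie is an
ascent exactly for an even letter. -/
lemma wordAsc_iff {n K : ℕ} (w : Fin n → Fin K) (π : Equiv.Perm (Fin n))
    (hπ : StrictMono (standardKey w ∘ (π⁻¹ : Equiv.Perm (Fin n)))) (i : ℕ) :
    wordAsc w i ↔ ∃ h : i + 1 < n, π ⟨i, by omega⟩ < π ⟨i + 1, h⟩ := by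
  refine exists_congr fun h => ?_
  have h1 := standardKey_lt_iff w (i := ⟨i, by omega⟩) (j := ⟨i + 1, h⟩) (by simp)
  have h2 := hπ.lt_iff_lt (a := π ⟨i, by omega⟩) (b := π ⟨i + 1, h⟩)
  simp only [Function.comp_apply, ← Equiv.Perm.mul_apply, inv_mul_cancel,
    Equiv.Perm.one_apply] at h2
  rw [← h2, h1]
  simp [Fin.lt_def]

open Classical in
/-- Summing over permutations, weighted by compatible sequences, is summing over words. -/
theorem sum_perm_eq_sum_word {R : Type} [CommRing R] (s : R) (m n K : ℕ) :
    (∑ π : Equiv.Perm (Fin n), s ^ occ (1 : Equiv.Perm (Fin m)) π *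
      ∑ f : Fin n → Fin K, if Compatible (descentData π⁻¹) f then (1 : R) else 0) =
    ∑ w : Fin n → Fin K, s ^ ascOcc m (wordAsc w) n := by
  have h1 : ∀ π : Equiv.Perm (Fin n),
      (∑ f : Fin n → Fin K, if Compatible (descentData π⁻¹) f then (1 : R) else 0) =
      ∑ w : Fin n → Fin K,
        if StrictMono (standardKey w ∘ (π⁻¹ : Equiv.Perm (Fin n))) then (1 : R) else 0 := by
    intro π
    -- The substitution `f = w ∘ π⁻¹`.
    rw [← (Equiv.arrowCongr π (Equiv.refl (Fin K))).sum_comp]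
    refine Finset.sum_congr rfl fun w _ => ?_
    exact if_congr (compatible_iff_strictMono w π⁻¹) rfl rfl
  simp_rw [h1, Finset.mul_sum]
  rw [Finset.sum_comm]
  refine Finset.sum_congr rfl fun w _ => ?_
  obtain ⟨π, hπ⟩ := existsUnique_standardization w
  rw [Finset.sum_eq_single π]
  · have h := (hπ π).2 rfl
    rw [if_pos h, mul_one, occ_one_eq_ascOcc]
    congr 2
    ext i
    exact (wordAsc_iff w π h i).symm
  · intro τ _ hτ
    rw [if_neg fun h => hτ ((hπ τ).1 h), mul_zero]
  · simp

/-! ### Increasing runs and occurrences of `12⋯m` -/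

open Classical in
/-- The length of the last increasing run among the first `p` letters. -/
noncomputable def runLen (asc : ℕ → Prop) : ℕ → ℕ
  | 0 => 0
  | 1 => 1
  | p + 2 => if asc p then runLen asc (p + 1) + 1 else 1

lemma runLen_pos (asc : ℕ → Prop) (p : ℕ) : 1 ≤ runLen asc (p + 1) := by
  cases p with
  | zero => simp [runLen]
  | succ p => rw [runLen]; split_ifs <;> omega

lemma runLen_le (asc : ℕ → Prop) (p : ℕ) : runLen asc p ≤ p := by
  induction p with
  | zero => simp [runLen]
  | succ p ih =>
    cases p with
    | zero => simp [runLen]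
    | succ p => rw [runLen]; split_ifs <;> omega

lemma le_runLen_iff (asc : ℕ → Prop) (j p : ℕ) :
    j ≤ runLen asc p ↔ j ≤ p ∧ ∀ i, p - j ≤ i → i + 1 < p → asc i := by
  induction p generalizing j with
  | zero => simp [runLen]
  | succ p ih =>
    cases p with
    | zero =>
      simp only [runLen, zero_add, iff_self_and]
      intro _ i _ h
      omega
    | succ p =>
      rcases Nat.lt_or_ge j 2 with hj | hj
      · have := runLen_pos asc (p + 1)
        exact ⟨fun _ => ⟨by omega, fun i _ _ => by omega⟩, fun _ => by omega⟩
      · obtain ⟨j, rfl⟩ : ∃ l, j = l + 1 := ⟨j - 1, by omega⟩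
        rw [runLen]
        by_cases h : asc p
        · rw [if_pos h, Nat.add_le_add_iff_right, ih j]
          constructor
          · rintro ⟨h1, h2⟩
            refine ⟨by omega, fun i h3 h4 => ?_⟩
            rcases Nat.lt_or_ge i p with h5 | h5
            · exact h2 i (by omega) (by omega)
            · rwa [show i = p by omega]
          · rintro ⟨h1, h2⟩
            exact ⟨by omega, fun i h3 h4 => h2 i (by omega) (by omega)⟩
        · rw [if_neg h]
          constructor
          · intro _
            omega
          · rintro ⟨h1, h2⟩
            exact absurd (h2 p (by omega) (by omega)) h

/-- The inequality is strict because deleting the whole last run would expose the run before it. -/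
lemma runLen_sub (asc : ℕ → Prop) (j p : ℕ) (hj : j < runLen asc p) :
    runLen asc (p - j) = runLen asc p - j := by
  have hp := runLen_le asc p
  refine le_antisymm ?_ ?_
  · obtain ⟨h1, h2⟩ := (le_runLen_iff asc _ (p - j)).1 le_rfl
    obtain ⟨h3, h4⟩ := (le_runLen_iff asc _ p).1 le_rfl
    have : runLen asc (p - j) + j ≤ runLen asc p := by
      rw [le_runLen_iff]
      refine ⟨by omega, fun i h5 h6 => ?_⟩
      rcases Nat.lt_or_ge (i + 1) (p - j) with h7 | h7
      · exact h2 i (by omega) h7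
      · exact h4 i (by omega) h6
    omega
  · obtain ⟨h3, h4⟩ := (le_runLen_iff asc _ p).1 le_rfl
    rw [le_runLen_iff]
    exact ⟨by omega, fun i h5 h6 => h4 i (by omega) (by omega)⟩

lemma ascOcc_congr {m p : ℕ} {asc asc' : ℕ → Prop} (h : ∀ i, i + 1 < p → (asc i ↔ asc' i)) :
    ascOcc m asc p = ascOcc m asc' p := by
  unfold ascOcc
  congr 1
  ext i
  simp only [Finset.mem_filter, and_congr_right_iff]
  intro _ h1
  refine forall_congr' fun a => forall_congr' fun ha => h _ (by omega)

lemma ascOcc_zero {m : ℕ} (hm : 1 ≤ m) (asc : ℕ → Prop) : ascOcc m asc 0 = 0 := by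
  classical
  unfold ascOcc
  rw [Finset.card_eq_zero, Finset.filter_eq_empty_iff]
  rintro i _ ⟨h, _⟩
  omega

/-- A new occurrence must end at the new letter, so it lies in the last run. -/
lemma ascOcc_succ {m : ℕ} (hm : 1 ≤ m) (asc : ℕ → Prop) (p : ℕ) :
    ascOcc m asc (p + 1) = ascOcc m asc p + if m ≤ runLen asc (p + 1) then 1 else 0 := by
  classical
  have h0 : ascOcc m asc (p + 1) = ((Finset.range (p + 1)).filter fun i =>
      i + m ≤ p + 1 ∧ ∀ a, a + 1 < m → asc (i + a)).card := by
    unfold ascOcc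
    congr 1
    ext i
    simp only [Finset.mem_filter, Finset.mem_range]
    constructor
    · rintro ⟨h1, h2, h3⟩
      exact ⟨by omega, h2, h3⟩
    · rintro ⟨h1, h2, h3⟩
      exact ⟨by omega, h2, h3⟩
  rw [h0]
  unfold ascOcc
  split_ifs with h
  · rw [le_runLen_iff] at h
    have : ((Finset.range (p + 1)).filter fun i =>
        i + m ≤ p + 1 ∧ ∀ a, a + 1 < m → asc (i + a)) =
        insert (p + 1 - m) ((Finset.range (p + 1)).filter fun i =>
        i + m ≤ p ∧ ∀ a, a + 1 < m → asc (i + a)) := by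
      ext i
      simp only [Finset.mem_filter, Finset.mem_range, Finset.mem_insert]
      constructor
      · rintro ⟨h1, h2, h3⟩
        rcases Nat.lt_or_ge p (i + m) with h4 | h4
        · exact Or.inl (by omega)
        · exact Or.inr ⟨h1, h4, h3⟩
      · rintro (h1 | ⟨h1, h2, h3⟩)
        · exact ⟨by omega, by omega, fun a ha => h.2 _ (by omega) (by omega)⟩
        · exact ⟨h1, by omega, h3⟩
    rw [this, Finset.card_insert_of_notMem]
    simp only [Finset.mem_filter, Finset.mem_range, not_and]
    intro _ h2
    omega
  · rw [add_zero]
    congr 1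
    ext i
    simp only [Finset.mem_filter, Finset.mem_range, and_congr_right_iff]
    intro h1
    constructor
    · rintro ⟨h2, h3⟩
      refine ⟨?_, h3⟩
      by_contra h4
      apply h
      rw [le_runLen_iff]
      refine ⟨by omega, fun j h5 h6 => ?_⟩
      have := h3 (j - i) (by omega)
      rwa [show i + (j - i) = j by omega] at this
    · rintro ⟨h2, h3⟩
      exact ⟨by omega, h3⟩

/-- No occurrence crosses the boundary of a run, and a run of length `r` holds `r + 1 - m` of them,
in truncated subtraction. -/
lemma ascOcc_eq_add {m : ℕ} (hm : 2 ≤ m) (asc : ℕ → Prop) (p : ℕ) :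
    ascOcc m asc p = ascOcc m asc (p - runLen asc p) + (runLen asc p + 1 - m) := by
  induction p with
  | zero => simp [runLen]; omega
  | succ p ih =>
    rw [ascOcc_succ (by omega)]
    cases p with
    | zero =>
      rw [if_neg (by simp [runLen]; omega)]
      simp [runLen]
      omega
    | succ p =>
      have h1 := runLen_le asc (p + 1)
      by_cases h : asc p
      · have h2 : runLen asc (p + 1 + 1) = runLen asc (p + 1) + 1 := by rw [runLen, if_pos h]
        rw [h2, ih, show p + 1 + 1 - (runLen asc (p + 1) + 1) = p + 1 - runLen asc (p + 1) by omega]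
        split_ifs <;> omega
      · have h2 : runLen asc (p + 1 + 1) = 1 := by rw [runLen, if_neg h]
        rw [h2, if_neg (by omega), show p + 1 + 1 - 1 = p + 1 by omega]
        omega

lemma ascOcc_sub {m : ℕ} (hm : 2 ≤ m) (asc : ℕ → Prop) (p j : ℕ) (hj : j ≤ runLen asc p) :
    ascOcc m asc (p - j) =
      ascOcc m asc (p - runLen asc p) + (runLen asc p - j + 1 - m) := by
  have := runLen_le asc p
  rcases hj.lt_or_eq with h | h
  · rw [ascOcc_eq_add hm asc (p - j), runLen_sub asc j p h]
    congr 2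
    omega
  -- The whole run is removed; the second summand `0 + 1 - m` truncates to `0`.
  · rw [h]
    omega

/-! ### The run theorem -/

section RunTheorem

variable {R : Type} [CommRing R]

/-- The weights of increasing runs: `s` to the number of occurrences of `12⋯m` in the run. -/
noncomputable def runSeries (s : R) (m : ℕ) : R⟦X⟧ := PowerSeries.mk fun r => s ^ (r + 1 - m)

-- Only suffixes inside the last run contribute. If that run has length `r`, the prefix before it
-- gives a common factor, and what remains is the coefficient of `y^r` in `γ * runSeries s m = 1`.
-- It vanishes unless `r = 0`, that is, `p = 0`.
open Classical in
lemma sum_run_weights (s : R) {m : ℕ} (hm : 2 ≤ m) (γ : R⟦X⟧) (hγ : γ * runSeries s m = 1)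
    (asc : ℕ → Prop) (p : ℕ) :
    (∑ qj ∈ Finset.HasAntidiagonal.antidiagonal p, PowerSeries.coeff qj.2 γ *
      if qj.2 ≤ runLen asc p then s ^ ascOcc m asc qj.1 else 0) = if p = 0 then 1 else 0 := by
  have hp := runLen_le asc p
  rw [← Finset.Nat.sum_antidiagonal_swap, Finset.Nat.sum_antidiagonal_eq_sum_range_succ_mk]
  simp only [Prod.snd_swap, Prod.fst_swap]
  have h1 : ∀ j ∈ Finset.range (runLen asc p + 1),
      (PowerSeries.coeff j γ * if j ≤ runLen asc p then s ^ ascOcc m asc (p - j) else 0) =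
      s ^ ascOcc m asc (p - runLen asc p) *
        (PowerSeries.coeff j γ * s ^ (runLen asc p - j + 1 - m)) := by
    intro j hj
    have hj' : j ≤ runLen asc p := by simpa [Nat.lt_succ_iff] using hj
    rw [if_pos hj', ascOcc_sub hm asc p j hj', pow_add]
    ring
  rw [← Finset.sum_subset (s₁ := Finset.range (runLen asc p + 1)), Finset.sum_congr rfl h1,
    ← Finset.mul_sum]
  · have h2 := congrArg (PowerSeries.coeff (runLen asc p)) hγ
    rw [PowerSeries.coeff_mul, Finset.Nat.sum_antidiagonal_eq_sum_range_succ_mk] at h2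
    simp only [runSeries, PowerSeries.coeff_mk] at h2
    rw [h2, PowerSeries.coeff_one]
    cases p with
    | zero => simp [runLen, ascOcc_zero (show 1 ≤ m by omega)]
    | succ p =>
      have := runLen_pos asc p
      rw [if_neg (by omega), if_neg (by omega), mul_zero]
  · intro j
    simp only [Finset.mem_range]
    omega
  · intro j _ hj
    rw [if_neg, mul_zero]
    simpa [Nat.lt_succ_iff] using hj

-- The condition on the last `j` letters compares none of them with the letters before the cut, so
-- prefix and suffix are independent.
open Classical in
lemma sum_word_append (s : R) (m K q j : ℕ) :
    (∑ w : Fin (q + j) → Fin K,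
      if j ≤ runLen (wordAsc w) (q + j) then s ^ ascOcc m (wordAsc w) q else 0) =
    (∑ w : Fin q → Fin K, s ^ ascOcc m (wordAsc w) q) *
      ∑ f : Fin j → Fin K, if Compatible (fun _ => False) f then (1 : R) else 0 := by
  rw [← (Fin.appendEquiv q j).sum_comp, Fintype.sum_prod_type, Finset.sum_mul_sum]
  refine Finset.sum_congr rfl fun v _ => Finset.sum_congr rfl fun f _ => ?_
  change (if j ≤ runLen (wordAsc (Fin.append v f)) (q + j) then
    s ^ ascOcc m (wordAsc (Fin.append v f)) q else 0) = _
  have hl : ∀ i (h : i < q) (h' : i < q + j), Fin.append v f ⟨i, h'⟩ = v ⟨i, h⟩ :=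
    fun i h h' => Fin.append_left v f ⟨i, h⟩
  have hr : ∀ i (h : i < j) (h' : q + i < q + j), Fin.append v f ⟨q + i, h'⟩ = f ⟨i, h⟩ :=
    fun i h h' => Fin.append_right v f ⟨i, h⟩
  have h1 : ascOcc m (wordAsc (Fin.append v f)) q = ascOcc m (wordAsc v) q := by
    refine ascOcc_congr fun i hi => ?_
    unfold wordAsc
    constructor
    · rintro ⟨h, H⟩
      rw [hl i (by omega), hl (i + 1) (by omega)] at H
      exact ⟨hi, H⟩
    · rintro ⟨h, H⟩
      refine ⟨by omega, ?_⟩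
      rw [hl i (by omega), hl (i + 1) (by omega)]
      exact H
  have h2 : j ≤ runLen (wordAsc (Fin.append v f)) (q + j) ↔ Compatible (fun _ => False) f := by
    rw [le_runLen_iff]
    constructor
    · rintro ⟨_, H⟩ i h
      obtain ⟨h3, h4⟩ := H (q + i) (by omega) (by omega)
      rw [hr i (by omega)] at h4
      have e : Fin.append v f ⟨q + i + 1, h3⟩ = f ⟨i + 1, h⟩ := hr (i + 1) h (by omega)
      rwa [e] at h4
    · intro H
      refine ⟨by omega, fun i h3 h4 => ⟨h4, ?_⟩⟩
      obtain ⟨i, rfl⟩ : ∃ l, i = q + l := ⟨i - q, by omega⟩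
      have h5 := H i (by omega)
      rw [hr i (by omega)]
      have e : Fin.append v f ⟨q + i + 1, h4⟩ = f ⟨i + 1, by omega⟩ :=
        hr (i + 1) (by omega) (by omega)
      rwa [e]
  rw [h1]
  simp only [h2]
  split_ifs <;> simp

open Classical in
/-- The run theorem: words weighted by occurrences of `12⋯m` are counted by the reciprocal of a
series in the numbers of increasing words. -/
theorem run_theorem (s : R) {m : ℕ} (hm : 2 ≤ m) (γ : R⟦X⟧) (hγ : γ * runSeries s m = 1) (K : ℕ) :
    (PowerSeries.mk fun n => ∑ w : Fin n → Fin K, s ^ ascOcc m (wordAsc w) n) *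
      (PowerSeries.mk fun j => PowerSeries.coeff j γ *
        ∑ f : Fin j → Fin K, if Compatible (fun _ => False) f then (1 : R) else 0) = 1 := by
  ext p
  rw [PowerSeries.coeff_mul, PowerSeries.coeff_one]
  simp only [PowerSeries.coeff_mk]
  -- Each product counts words of length `p` with a marked increasing suffix; exchanging sums then
  -- fixes the word and varies the suffix.
  have h1 : ∀ qj ∈ Finset.HasAntidiagonal.antidiagonal p,
      ((∑ w : Fin qj.1 → Fin K, s ^ ascOcc m (wordAsc w) qj.1) * (PowerSeries.coeff qj.2 γ *
        ∑ f : Fin qj.2 → Fin K, if Compatible (fun _ => False) f then (1 : R) else 0)) =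
      ∑ w : Fin p → Fin K, PowerSeries.coeff qj.2 γ *
        if qj.2 ≤ runLen (wordAsc w) p then s ^ ascOcc m (wordAsc w) qj.1 else 0 := by
    rintro ⟨q, j⟩ hqj
    obtain rfl : q + j = p := by simpa using hqj
    rw [← Finset.mul_sum, sum_word_append]
    ring
  rw [Finset.sum_congr rfl h1, Finset.sum_comm]
  simp_rw [sum_run_weights s hm γ hγ]
  split_ifs with h
  · subst h
    simp
  · simp

end RunTheorem

/-! ### Series in `x` and `t`, and substitution of `z` -/

section Bivariate

variable {R : Type} [CommRing R]

/-- Series in `t` alone, as series in `x` and `t`. -/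
noncomputable def constX : R⟦X⟧ →+* SeriesTX R := PowerSeries.map (PowerSeries.C : R →+* R⟦X⟧)

/-- The series `∑_n a_n x^n`, where the `a_n` are series in `t`. -/
noncomputable def assemble (a : ℕ → R⟦X⟧) : SeriesTX R :=
  PowerSeries.mk fun k => PowerSeries.mk fun n => PowerSeries.coeff k (a n)

lemma coeff_assemble (a : ℕ → R⟦X⟧) (k : ℕ) :
    PowerSeries.coeff k (assemble a) = PowerSeries.mk fun n => PowerSeries.coeff k (a n) := by
  rw [assemble, PowerSeries.coeff_mk]

lemma coeff_constX_mul_x_pow (a : R⟦X⟧) (n k : ℕ) :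
    PowerSeries.coeff k (constX a * x ^ n) =
      PowerSeries.C (PowerSeries.coeff k a) * PowerSeries.X ^ n := by
  rw [x, ← map_pow, PowerSeries.coeff_mul_C, constX, PowerSeries.coeff_map]

lemma constX_mul_assemble (b : R⟦X⟧) (a : ℕ → R⟦X⟧) :
    constX b * assemble a = assemble fun n => b * a n := by
  ext k n
  rw [PowerSeries.coeff_mul, coeff_assemble, PowerSeries.coeff_mk, PowerSeries.coeff_mul, map_sum]
  refine Finset.sum_congr rfl fun ij _ => ?_
  rw [constX, PowerSeries.coeff_map, coeff_assemble, PowerSeries.coeff_C_mul, PowerSeries.coeff_mk]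

lemma hasFormalSumTX_assemble (a : ℕ → R⟦X⟧) :
    HasFormalSumTX (fun n => constX (a n) * x ^ n) (assemble a) := by
  intro k i
  simp only [coeff_constX_mul_x_pow, coeff_assemble, PowerSeries.coeff_C_mul,
    PowerSeries.coeff_X_pow, PowerSeries.coeff_mk]
  constructor
  · refine (Set.finite_singleton i).subset fun n hn => ?_
    by_contra h
    exact hn (by simp [show i ≠ n from fun h' => h h'.symm])
  · rw [finsum_eq_single _ i fun n hn => by simp [hn.symm]]
    simp

lemma t_eq : (t : SeriesTX R) = constX PowerSeries.X := by simp [t, constX]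

lemma scalar_eq (r : R) : (scalar r : SeriesTX R) = constX (PowerSeries.C r) := by
  simp [scalar, constX]

lemma u_eq : (u : SeriesTX R) = constX (uT R) := by
  rw [uT, map_frac _ ((isUnit_one_add_X R).pow 2), u, t_eq, map_mul,
    map_ofNat constX 4, map_pow, map_add, map_one]

lemma isUnit_one_sub_t : IsUnit (1 - t : SeriesTX R) := by
  rw [t_eq, ← map_one constX, ← map_sub]
  exact (isUnit_one_sub_X R).map _

lemma isUnit_one_add_t : IsUnit (1 + t : SeriesTX R) := by
  rw [t_eq, ← map_one constX, ← map_add]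
  exact (isUnit_one_add_X R).map _

lemma z_eq : (z : SeriesTX R) = constX (zT R) * x := by
  rw [z]
  apply frac_eq_of_mul_eq isUnit_one_sub_t
  have h := congrArg constX (zT_mul R)
  simp only [map_mul, map_sub, map_add, map_one, ← t_eq] at h
  linear_combination x * h

lemma one_div_one_sub_t : frac 1 (1 - t : SeriesTX R) = constX (geomT R) := by
  apply frac_eq_of_mul_eq isUnit_one_sub_t
  have h := congrArg constX (geomT_mul R)
  simpa only [map_mul, map_sub, map_one, ← t_eq] using h

/-- Substitution of `z` for the variable of a univariate series. -/
noncomputable def substZ : R⟦X⟧ →+* SeriesTX R where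
  toFun b := assemble fun n => PowerSeries.C (PowerSeries.coeff n b) * zT R ^ n
  map_one' := by
    ext k n
    rw [coeff_assemble, PowerSeries.coeff_mk, PowerSeries.coeff_C_mul, PowerSeries.coeff_one,
      PowerSeries.coeff_one]
    rcases Nat.eq_zero_or_pos n with rfl | hn
    · by_cases hk : k = 0 <;> simp [PowerSeries.coeff_one, hk]
    · by_cases hk : k = 0 <;> simp [PowerSeries.coeff_one, hn.ne', hk]
  map_zero' := by
    ext k n
    simp [coeff_assemble]
  map_add' a b := by
    ext k n
    simp [coeff_assemble, add_mul]
  map_mul' a b := by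
    ext k n
    rw [PowerSeries.coeff_mul, map_sum, coeff_assemble, PowerSeries.coeff_mk,
      PowerSeries.coeff_C_mul, PowerSeries.coeff_mul, Finset.sum_mul]
    have h1 : ∀ kl ∈ Finset.HasAntidiagonal.antidiagonal k,
        PowerSeries.coeff n
          (PowerSeries.coeff kl.1 (assemble fun n => PowerSeries.C (PowerSeries.coeff n a) *
              zT R ^ n) *
            PowerSeries.coeff kl.2 (assemble fun n => PowerSeries.C (PowerSeries.coeff n b) *
              zT R ^ n)) =
        ∑ ij ∈ Finset.HasAntidiagonal.antidiagonal n,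
          PowerSeries.coeff ij.1 a * PowerSeries.coeff ij.2 b *
            (PowerSeries.coeff kl.1 (zT R ^ ij.1) * PowerSeries.coeff kl.2 (zT R ^ ij.2)) := by
      intro kl _
      rw [PowerSeries.coeff_mul]
      refine Finset.sum_congr rfl fun ij _ => ?_
      simp only [coeff_assemble, PowerSeries.coeff_mk, PowerSeries.coeff_C_mul]
      ring
    -- For fixed `x`-degrees `i + j = n`, the sum over `t`-degrees is a coefficient of `zT^i * zT^j
    -- = zT^n`.
    rw [Finset.sum_congr rfl h1, Finset.sum_comm]
    refine Finset.sum_congr rfl fun ij hij => ?_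
    rw [← Finset.mul_sum, ← PowerSeries.coeff_mul, ← pow_add,
      Finset.HasAntidiagonal.mem_antidiagonal.1 hij]

lemma substZ_apply (b : R⟦X⟧) :
    substZ b = assemble fun n => PowerSeries.C (PowerSeries.coeff n b) * zT R ^ n := rfl

lemma substZ_X : substZ (PowerSeries.X : R⟦X⟧) = z := by
  rw [z_eq]
  ext k n
  rw [← pow_one x, coeff_constX_mul_x_pow, substZ_apply, coeff_assemble, PowerSeries.coeff_mk,
    PowerSeries.coeff_C_mul, PowerSeries.coeff_C_mul, PowerSeries.coeff_X, PowerSeries.coeff_X_pow]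
  by_cases hn : n = 1 <;> simp [hn]

lemma substZ_C (r : R) : substZ (PowerSeries.C r : R⟦X⟧) = scalar r := by
  rw [scalar_eq]
  ext k n
  rw [← mul_one (constX _), ← pow_zero x, coeff_constX_mul_x_pow, substZ_apply, coeff_assemble,
    PowerSeries.coeff_mk, PowerSeries.coeff_C_mul, PowerSeries.coeff_C, pow_zero, mul_one,
    PowerSeries.coeff_C, PowerSeries.coeff_C]
  by_cases hn : n = 0 <;> by_cases hk : k = 0 <;> simp [hn, hk, PowerSeries.coeff_one]

lemma coeff_hadamardPow (f : SeriesTX R) (n k : ℕ) :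
    PowerSeries.coeff k (hadamardPow f n) = PowerSeries.coeff k f ^ n := by
  induction n with
  | zero => simp [hadamardPow]
  | succ n ih => rw [hadamardPow, hadamard, PowerSeries.coeff_mk, ih, pow_succ]

/-- The geometric series of a series without constant term. -/
lemma hasFormalSumX_pow {f g : R⟦X⟧} (hf : PowerSeries.constantCoeff f = 0)
    (hfg : g * (1 - f) = 1) : HasFormalSumX (fun n => f ^ n) g := by
  have hX : PowerSeries.X ∣ f := PowerSeries.X_dvd_iff.2 hf
  have h0 : ∀ (h : R⟦X⟧) (i n : ℕ), i < n → PowerSeries.coeff i (f ^ n * h) = 0 := by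
    intro h i n hin
    exact PowerSeries.X_pow_dvd_iff.1 ((pow_dvd_pow_of_dvd hX n).mul_right h) i hin
  -- The finite geometric sum with remainder `f^n g`, which is divisible by `X^n`.
  have h1 : ∀ n, g = ∑ j ∈ Finset.range n, f ^ j + f ^ n * g := by
    intro n
    have h2 := geom_sum_mul f n
    linear_combination g * h2 + (∑ j ∈ Finset.range n, f ^ j) * hfg
  intro i
  have hs : (Function.support fun n => PowerSeries.coeff i (f ^ n)) ⊆
      (Finset.range (i + 1) : Finset ℕ) := by
    intro n hn
    by_contra h
    apply hn
    have := h0 1 i n (by simpa using h)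
    simpa using this
  refine ⟨(Finset.finite_toSet _).subset hs, ?_⟩
  rw [finsum_eq_sum_of_support_subset _ hs]
  conv_rhs => rw [h1 (i + 1), map_add, h0 g i (i + 1) (by omega), add_zero, map_sum]

/-! ### The reciprocal of the run series -/

lemma isUnit_frac_denominator (s : R) (m : ℕ) :
    IsUnit (1 - (PowerSeries.C s - 1) * ∑ l ∈ Finset.Icc 1 (m - 1), PowerSeries.X ^ l : R⟦X⟧) := by
  rw [PowerSeries.isUnit_iff_constantCoeff, map_sub, map_mul, map_sum,
    Finset.sum_eq_zero, mul_zero, map_one, sub_zero]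
  · exact isUnit_one
  · intro l hl
    have : l ≠ 0 := by simp only [Finset.mem_Icc] at hl; omega
    simp [this]

/-- The reciprocal `(1 - s y) / (1 - (s - 1) (y + ⋯ + y^(m-1)))` of the run series. -/
noncomputable def runInverse (s : R) (m : ℕ) : R⟦X⟧ :=
  frac (1 - PowerSeries.C s * PowerSeries.X)
    (1 - (PowerSeries.C s - 1) * ∑ l ∈ Finset.Icc 1 (m - 1), PowerSeries.X ^ l)

lemma runInverse_mul_denominator (s : R) (m : ℕ) : runInverse s m *
    (1 - (PowerSeries.C s - 1) * ∑ l ∈ Finset.Icc 1 (m - 1), PowerSeries.X ^ l) =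
    1 - PowerSeries.C s * PowerSeries.X :=
  frac_mul_cancel (isUnit_frac_denominator s m)

lemma coeff_sum_X_pow_Icc (m r : ℕ) :
    PowerSeries.coeff r (∑ l ∈ Finset.Icc 1 (m - 1), PowerSeries.X ^ l : R⟦X⟧) =
      if 1 ≤ r ∧ r < m then 1 else 0 := by
  simp only [map_sum, PowerSeries.coeff_X_pow, Finset.sum_ite_eq, Finset.mem_Icc]
  refine if_congr ?_ rfl rfl
  omega

lemma one_sub_X_mul_sum {m : ℕ} (hm : 1 ≤ m) :
    (1 - PowerSeries.X) * ∑ l ∈ Finset.Icc 1 (m - 1), PowerSeries.X ^ l =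
      (PowerSeries.X - PowerSeries.X ^ m : R⟦X⟧) := by
  induction m, hm using Nat.le_induction with
  | base => simp
  | succ n hn ih =>
    obtain ⟨n, rfl⟩ : ∃ l, n = l + 1 := ⟨n - 1, by omega⟩
    rw [show n + 1 + 1 - 1 = n + 1 by omega, Finset.sum_Icc_succ_top (by omega), mul_add]
    rw [show n + 1 - 1 = n by omega] at ih
    rw [ih]
    ring

/-- Multiplication by `1 - s y` makes the run series telescope: the weights are `1` below length `m`
and geometric with ratio `s` from length `m - 1` on. -/
lemma runInverse_mul_runSeries (s : R) {m : ℕ} (hm : 2 ≤ m) :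
    runInverse s m * runSeries s m = 1 := by
  have h1 : runSeries s m * (1 - PowerSeries.C s * PowerSeries.X) =
      1 - (PowerSeries.C s - 1) * ∑ l ∈ Finset.Icc 1 (m - 1), PowerSeries.X ^ l := by
    have e : (PowerSeries.C s - 1 : R⟦X⟧) = PowerSeries.C (s - 1) := by simp
    rw [e]
    ext r
    rw [mul_sub, mul_one, map_sub, map_sub, PowerSeries.coeff_C_mul, coeff_sum_X_pow_Icc,
      ← mul_assoc, mul_comm (runSeries s m), PowerSeries.coeff_one]
    cases r with
    | zero =>
      simp [runSeries, show 1 - m = 0 by omega]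
    | succ r =>
      rw [PowerSeries.coeff_succ_mul_X, PowerSeries.coeff_C_mul]
      simp only [runSeries, PowerSeries.coeff_mk]
      rw [if_neg (Nat.succ_ne_zero r)]
      rcases Nat.lt_or_ge (r + 1) m with h | h
      · rw [if_pos ⟨by omega, h⟩, show r + 1 + 1 - m = 0 by omega, show r + 1 - m = 0 by omega]
        simp
      · rw [if_neg (by omega), show r + 1 + 1 - m = r + 1 - m + 1 by omega]
        simp [pow_succ']
  apply (isUnit_frac_denominator s m).mul_left_injective
  have h2 := runInverse_mul_denominator s m
  simp only
  linear_combination runSeries s m * h2 + h1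

/-- Divided by the denominator, this is the fraction of (a) in the variable `y`, without the factor
`1/(1-t)`. -/
lemma one_sub_runInverse_mul_denominator (s : R) {m : ℕ} (hm : 2 ≤ m) : (1 - runInverse s m) *
    (1 - (PowerSeries.C s - 1) * ∑ l ∈ Finset.Icc 1 (m - 1), PowerSeries.X ^ l) =
    PowerSeries.X * (1 - (PowerSeries.C s - 1) * ∑ l ∈ Finset.Icc 1 (m - 1), PowerSeries.X ^ l) +
      (PowerSeries.C s - 1) * PowerSeries.X ^ m := by
  have h1 := one_sub_X_mul_sum (R := R) (show 1 ≤ m by omega)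
  have h2 := runInverse_mul_denominator s m
  linear_combination - h2 - (PowerSeries.C s - 1) * h1

lemma constantCoeff_runInverse (s : R) {m : ℕ} (hm : 2 ≤ m) :
    PowerSeries.constantCoeff (runInverse s m) = 1 := by
  have h := congrArg PowerSeries.constantCoeff (runInverse_mul_runSeries s hm)
  rw [map_mul, map_one, ← PowerSeries.coeff_zero_eq_constantCoeff_apply (runSeries s m)] at h
  simpa [runSeries, show 1 - m = 0 by omega] using h

/-! ### Coefficients of `t^k` and Hadamard powers -/

/-- The generating function of the polynomials `∑_π s^occ u^ilpk`, with `s` in the scalars. -/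
noncomputable def ilpkSeries (s : R) (m : ℕ) : SeriesTX R :=
  assemble fun n => (∑ π : Equiv.Perm (Fin n),
    PowerSeries.C (s ^ occ (1 : Equiv.Perm (Fin m)) π) * uT R ^ ilpk π) * zT R ^ n

lemma hasFormalSumTX_ilpkSeries (s : R) (m : ℕ) :
    HasFormalSumTX (fun n => (∑ π : Equiv.Perm (Fin n),
      scalar (s ^ occ (1 : Equiv.Perm (Fin m)) π) * u ^ ilpk π) * z ^ n) (ilpkSeries s m) := by
  rw [ilpkSeries]
  convert hasFormalSumTX_assemble _ using 2 with n
  rw [u_eq, z_eq, mul_pow, ← mul_assoc, map_mul, map_sum, map_pow]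
  simp only [map_mul, map_pow, scalar_eq]

/-- The coefficient of `t^k` in `1 - ∑_j β_j z^j / (1-t)`, for the run inverse `1 - β`. -/
noncomputable def layerInverse (s : R) (m k : ℕ) : R⟦X⟧ :=
  PowerSeries.mk fun j =>
    PowerSeries.coeff j (runInverse s m) * PowerSeries.coeff k (geomT R * zT R ^ j)

/-- This is `run_theorem` over the alphabet `0, …, 2k`. Both factors are counts of compatible
sequences: for the descents of each `π⁻¹` on the left, and for no descents, hence no factor `u`, on
the right. -/
lemma coeff_ilpkSeries_mul_layerInverse (s : R) {m : ℕ} (hm : 2 ≤ m) (k : ℕ) :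
    PowerSeries.coeff k (frac 1 (1 - t) * ilpkSeries s m) * layerInverse s m k = 1 := by
  classical
  rw [← run_theorem s hm (runInverse s m) (runInverse_mul_runSeries s hm) (2 * k + 1),
    one_div_one_sub_t, ilpkSeries, constX_mul_assemble, coeff_assemble]
  congr 1
  · ext n
    rw [PowerSeries.coeff_mk, PowerSeries.coeff_mk, ← sum_perm_eq_sum_word, Finset.sum_mul,
      Finset.mul_sum, map_sum]
    refine Finset.sum_congr rfl fun π _ => ?_
    rw [sum_compatible_eq_coeff R _ (by simp [descentData]), ← PowerSeries.coeff_C_mul, ilpk,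
      lpk_eq]
    congr 1
    ring
  · ext j
    rw [layerInverse, PowerSeries.coeff_mk, PowerSeries.coeff_mk,
      sum_compatible_eq_coeff R _ (by simp)]
    simp

lemma coeff_geom_mul_substZ (s : R) (m k : ℕ) :
    PowerSeries.coeff k (constX (geomT R) * substZ (1 - runInverse s m)) =
      1 - layerInverse s m k := by
  have h : ∀ b : R⟦X⟧, PowerSeries.coeff k (constX (geomT R) * substZ b) =
      PowerSeries.mk fun j => PowerSeries.coeff j b * PowerSeries.coeff k (geomT R * zT R ^ j) := by
    intro b
    rw [substZ_apply, constX_mul_assemble, coeff_assemble]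
    ext j
    rw [PowerSeries.coeff_mk, PowerSeries.coeff_mk, ← PowerSeries.coeff_C_mul]
    congr 1
    ring
  -- All coefficients of `1/(1-t)` are `1`, so the constant `1` contributes `1` to every layer.
  have hg : geomT R = PowerSeries.mk 1 :=
    frac_eq_of_mul_eq (isUnit_one_sub_X R) (PowerSeries.mk_one_mul_one_sub_eq_one R)
  rw [map_sub substZ, mul_sub, map_sub, h, h]
  congr 1
  ext j
  rw [PowerSeries.coeff_mk, PowerSeries.coeff_one]
  by_cases hj : j = 0 <;> simp [hj, hg]

lemma constantCoeff_layerInverse (s : R) {m : ℕ} (hm : 2 ≤ m) (k : ℕ) :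
    PowerSeries.constantCoeff (layerInverse s m k) = 1 := by
  have hg : geomT R = PowerSeries.mk 1 :=
    frac_eq_of_mul_eq (isUnit_one_sub_X R) (PowerSeries.mk_one_mul_one_sub_eq_one R)
  rw [← PowerSeries.coeff_zero_eq_constantCoeff_apply, layerInverse, PowerSeries.coeff_mk,
    PowerSeries.coeff_zero_eq_constantCoeff_apply, constantCoeff_runInverse s hm]
  simp [hg]

/-- In each `t`-degree, Hadamard powers are ordinary powers of a series in `x` without constant
term. -/
theorem hasFormalSumTX_hadamardPow (s : R) {m : ℕ} (hm : 2 ≤ m) :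
    HasFormalSumTX (hadamardPow (constX (geomT R) * substZ (1 - runInverse s m)))
      (frac 1 (1 - t) * ilpkSeries s m) := by
  intro k
  simp only [coeff_hadamardPow, coeff_geom_mul_substZ]
  apply hasFormalSumX_pow
  · rw [map_sub, constantCoeff_layerInverse s hm, map_one, sub_self]
  · rw [sub_sub_cancel, coeff_ilpkSeries_mul_layerInverse s hm]

lemma isUnit_denominator_z (s : R) (m : ℕ) :
    IsUnit (1 - (scalar s - 1) * ∑ l ∈ Finset.Icc 1 (m - 1), z ^ l : SeriesTX R) := by
  have h := (isUnit_frac_denominator s m).map substZ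
  simpa only [map_sub, map_mul, map_one, map_sum, map_pow, substZ_X, substZ_C] using h

/-- The series whose Hadamard powers count by `occ` and `ilpk`. -/
lemma cluster_fraction_eq (s : R) {m : ℕ} (hm : 2 ≤ m) :
    frac z (1 - t) + frac ((scalar s - 1) * z ^ m)
      ((1 - t) * (1 - (scalar s - 1) * ∑ l ∈ Finset.Icc 1 (m - 1), z ^ l)) =
    constX (geomT R) * substZ (1 - runInverse s m) := by
  have hu := isUnit_denominator_z s m
  have ht := isUnit_one_sub_t (R := R)
  have h1 := congrArg substZ (one_sub_runInverse_mul_denominator s hm)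
  rw [map_mul, map_add, map_mul] at h1
  simp only [map_sub substZ (1 : R⟦X⟧) ((_ - 1) * _), map_sub substZ (PowerSeries.C s), map_mul,
    map_one, map_sum, map_pow, substZ_X, substZ_C] at h1
  have h2 := frac_mul_cancel (a := z) ht
  have h3 := frac_mul_cancel (a := (scalar s - 1) * z ^ m) (ht.mul hu)
  have h4 : constX (geomT R) * (1 - t) = 1 := by
    rw [← one_div_one_sub_t, frac_mul_cancel ht]
  apply (ht.mul hu).mul_left_injective
  simp only
  generalize (1 - (scalar s - 1) * ∑ l ∈ Finset.Icc 1 (m - 1), z ^ l : SeriesTX R) = d at *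
  linear_combination d * h2 + h3 - h1 - substZ (1 - runInverse s m) * d * h4

/-! ### The case `s = 0`: avoidance and explicit coefficients -/

lemma runInverse_zero_mul {m : ℕ} (hm : 2 ≤ m) :
    runInverse (0 : R) m * (1 - PowerSeries.X ^ m) = 1 - PowerSeries.X := by
  have h1 := one_sub_X_mul_sum (R := R) (show 1 ≤ m by omega)
  have h2 := runInverse_mul_denominator (0 : R) m
  rw [map_zero] at h2
  linear_combination (1 - PowerSeries.X) * h2 - runInverse (0 : R) m * h1

lemma isUnit_one_sub_X_pow {m : ℕ} (hm : 2 ≤ m) : IsUnit (1 - PowerSeries.X ^ m : R⟦X⟧) := by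
  simp [PowerSeries.isUnit_iff_constantCoeff, show m ≠ 0 by omega]

lemma isUnit_one_sub_z_pow {m : ℕ} (hm : 2 ≤ m) : IsUnit (1 - z ^ m : SeriesTX R) := by
  have h := (isUnit_one_sub_X_pow (R := R) hm).map substZ
  simpa only [map_sub, map_one, map_pow, substZ_X] using h

lemma avoidance_fraction_eq {m : ℕ} (hm : 2 ≤ m) :
    frac (z * (1 - z ^ (m - 1))) ((1 - t) * (1 - z ^ m)) =
    constX (geomT R) * substZ (1 - runInverse (0 : R) m) := by
  have ht := isUnit_one_sub_t (R := R)
  apply frac_eq_of_mul_eq (ht.mul (isUnit_one_sub_z_pow hm))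
  have h4 : constX (geomT R) * (1 - t) = 1 := by
    rw [← one_div_one_sub_t, frac_mul_cancel ht]
  have h1 : (1 - runInverse (0 : R) m) * (1 - PowerSeries.X ^ m) =
      PowerSeries.X * (1 - PowerSeries.X ^ (m - 1)) := by
    obtain ⟨m, rfl⟩ : ∃ l, m = l + 1 := ⟨m - 1, by omega⟩
    have := runInverse_zero_mul (R := R) hm
    rw [Nat.add_sub_cancel]
    linear_combination - this
  have h2 := congrArg substZ h1
  rw [map_mul] at h2
  simp only [map_sub substZ (1 : R⟦X⟧) (PowerSeries.X ^ _), map_mul,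
    map_one, map_pow, substZ_X] at h2
  linear_combination h2 + substZ (1 - runInverse (0 : R) m) * (1 - z ^ m) * h4

/-- The expansion of `(1-y)/(1-y^m)`. -/
lemma coeff_runInverse_zero {m : ℕ} (hm : 2 ≤ m) (i : ℕ) :
    PowerSeries.coeff i (runInverse (0 : R) m) =
      (if m ∣ i then 1 else 0) - if 1 ≤ i ∧ m ∣ i - 1 then 1 else 0 := by
  have h1 : (PowerSeries.mk fun i => if m ∣ i then (1 : R) else 0) * (1 - PowerSeries.X ^ m) =
      1 := by
    ext i
    rw [mul_sub, mul_one, map_sub, PowerSeries.coeff_mul_X_pow', PowerSeries.coeff_mk,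
      PowerSeries.coeff_mk, PowerSeries.coeff_one]
    rcases Nat.lt_or_ge i m with h | h
    · rw [if_neg (by omega : ¬ m ≤ i), sub_zero]
      refine if_congr ?_ rfl rfl
      exact ⟨fun h' => Nat.eq_zero_of_dvd_of_lt h' h, fun h' => h' ▸ dvd_zero m⟩
    · rw [if_pos h, if_neg (by omega : ¬ i = 0)]
      simp only [Nat.dvd_sub_iff_left h dvd_rfl, sub_self]
  have h2 : runInverse (0 : R) m =
      (PowerSeries.mk fun i => if m ∣ i then (1 : R) else 0) * (1 - PowerSeries.X) := by
    linear_combination - runInverse (0 : R) m * h1 +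
      (PowerSeries.mk fun i => if m ∣ i then (1 : R) else 0) * runInverse_zero_mul (R := R) hm
  rw [h2, mul_sub, mul_one, map_sub, PowerSeries.coeff_mk]
  cases i with
  | zero => simp
  | succ i => simp [PowerSeries.coeff_succ_mul_X]

/-- The series is `(1+t)^a / (1-t)^(a+1)`, a product of two binomial series. -/
lemma coeff_geomT_mul_zT_pow (a k : ℕ) : PowerSeries.coeff k (geomT R * zT R ^ a) =
    ((∑ l ∈ Finset.range (k + 1), (l + a).choose l * a.choose (k - l) : ℕ) : R) := by
  have h1 : geomT R * zT R ^ a =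
      (PowerSeries.mk fun n => ((a + n).choose a : R)) * (1 + PowerSeries.X) ^ a := by
    apply ((isUnit_one_sub_X R).pow (a + 1)).mul_left_injective
    have h2 := (PowerSeries.invOneSubPow R (a + 1)).val_inv
    rw [PowerSeries.invOneSubPow_val_succ_eq_mk_add_choose,
      PowerSeries.invOneSubPow_inv_eq_one_sub_pow] at h2
    have h3 := congrArg (· ^ a) (zT_mul R)
    simp only [mul_pow] at h3 ⊢
    linear_combination (1 - PowerSeries.X) * geomT R * h3 + (1 + PowerSeries.X) ^ a * geomT_mul R -
      (1 + PowerSeries.X) ^ a * h2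
  have h2 : ((1 + PowerSeries.X) ^ a : R⟦X⟧) = ((1 + Polynomial.X) ^ a : R[X]) := by simp
  rw [h1, PowerSeries.coeff_mul, Finset.Nat.sum_antidiagonal_eq_sum_range_succ_mk]
  push_cast
  refine Finset.sum_congr rfl fun l _ => ?_
  rw [PowerSeries.coeff_mk, h2, Polynomial.coeff_coe, Polynomial.coeff_one_add_X_pow, add_comm a l,
    Nat.choose_symm_add]

lemma hasFormalSumX_layerInverse_zero {m : ℕ} (hm : 2 ≤ m) (k : ℕ) :
    HasFormalSumX (fun j => PowerSeries.C (dCoeff m j k : R) * PowerSeries.X ^ (j * m) -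
      PowerSeries.C (dCoeff' m j k : R) * PowerSeries.X ^ (j * m + 1))
      (layerInverse (0 : R) m k) := by
  have hd : ∀ j, (dCoeff m j k : R) = PowerSeries.coeff k (geomT R * zT R ^ (j * m)) :=
    fun j => (coeff_geomT_mul_zT_pow (j * m) k).symm
  have hd' : ∀ j, (dCoeff' m j k : R) = PowerSeries.coeff k (geomT R * zT R ^ (j * m + 1)) :=
    fun j => (coeff_geomT_mul_zT_pow (j * m + 1) k).symm
  intro i
  have hc : ∀ j, PowerSeries.coeff i
      (PowerSeries.C (dCoeff m j k : R) * PowerSeries.X ^ (j * m) -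
        PowerSeries.C (dCoeff' m j k : R) * PowerSeries.X ^ (j * m + 1)) =
      ((if i = j * m then 1 else 0) - if i = j * m + 1 then 1 else 0) *
        PowerSeries.coeff k (geomT R * zT R ^ i) := by
    intro j
    rw [map_sub, PowerSeries.coeff_C_mul, PowerSeries.coeff_C_mul, PowerSeries.coeff_X_pow,
      PowerSeries.coeff_X_pow, hd, hd', sub_mul]
    congr 1
    · split_ifs with h <;> simp [h]
    · split_ifs with h <;> simp [h]
  simp only [hc]
  have hs : (Function.support fun j => ((if i = j * m then 1 else 0) -
      if i = j * m + 1 then 1 else 0) * PowerSeries.coeff k (geomT R * zT R ^ i)) ⊆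
      (Finset.range (i + 1) : Finset ℕ) := by
    intro j hj
    by_contra h
    apply hj
    have h1 : i < j := by simpa using h
    -- With `m` positive, an index `j > i` contributes only in degrees above `i`.
    have h2 : j ≤ j * m := Nat.le_mul_of_pos_right j (by omega)
    simp only
    rw [if_neg (by omega), if_neg (by omega), sub_zero, zero_mul]
  refine ⟨(Finset.finite_toSet _).subset hs, ?_⟩
  have hsum : ∀ r, r ≤ i → (∑ j ∈ Finset.range (i + 1), if r = j * m then (1 : R) else 0) =
      if m ∣ r then 1 else 0 := by
    intro r hr
    split_ifs with h
    · obtain ⟨c, rfl⟩ := h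
      have hcle : c ≤ m * c := Nat.le_mul_of_pos_left c (by omega)
      rw [Finset.sum_eq_single c]
      · simp [mul_comm]
      · intro j _ hj
        rw [if_neg]
        intro h
        rw [mul_comm j m] at h
        exact hj (Nat.eq_of_mul_eq_mul_left (by omega) h).symm
      · intro h
        simp only [Finset.mem_range] at h
        omega
    · refine Finset.sum_eq_zero fun j _ => if_neg ?_
      rintro rfl
      exact h (dvd_mul_left _ _)
  rw [finsum_eq_sum_of_support_subset _ hs, ← Finset.sum_mul, Finset.sum_sub_distrib, layerInverse,
    PowerSeries.coeff_mk, coeff_runInverse_zero hm, hsum i le_rfl]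
  congr 2
  cases i with
  | zero => simp
  | succ i =>
    simp only [Nat.add_right_cancel_iff]
    rw [hsum i (by omega)]
    simp

end Bivariate

/-! ### Evaluation of the polynomials and the theorem -/

lemma evalAt_ilpkPoly (m n : ℕ) (a : SeriesTX ℚ[X]) :
    evalAt (ilpkPoly (1 : Equiv.Perm (Fin m)) n) a =
      ∑ π : Equiv.Perm (Fin n),
        scalar (Polynomial.X ^ occ (1 : Equiv.Perm (Fin m)) π) * a ^ ilpk π := by
  rw [evalAt, ilpkPoly, Polynomial.eval₂_finsetSum]
  refine Finset.sum_congr rfl fun π _ => ?_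
  rw [Polynomial.eval₂_mul, Polynomial.eval₂_C, Polynomial.eval₂_X_pow]

/-- Since `0 ^ 0 = 1`, the factor `0 ^ occ` is the indicator of avoidance, which makes this the
instance `s = 0` of the general series. -/
lemma evalAt_ilpkPolyAvoid (m n : ℕ) (a : SeriesTX ℚ) :
    evalAt (ilpkPolyAvoid (1 : Equiv.Perm (Fin m)) n) a =
      ∑ π : Equiv.Perm (Fin n), scalar (0 ^ occ (1 : Equiv.Perm (Fin m)) π) * a ^ ilpk π := by
  rw [evalAt, ilpkPolyAvoid, ilpkPoly, Polynomial.map_sum, Polynomial.eval₂_finsetSum]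
  refine Finset.sum_congr rfl fun π _ => ?_
  rw [Polynomial.map_mul, Polynomial.map_C, Polynomial.map_pow, Polynomial.map_X,
    Polynomial.eval₂_mul, Polynomial.eval₂_C, Polynomial.eval₂_X_pow, map_pow,
    Polynomial.coe_evalRingHom, Polynomial.eval_X]

open SeriesTX in
theorem theorem4p7 (m : ℕ) (hm : 2 ≤ m) :
    -- all denominators below are units, so that the fractions are genuine
    (IsUnit (1 - t : SeriesTX ℚ[X]) ∧ IsUnit (1 + t : SeriesTX ℚ[X]) ∧
      IsUnit (1 - (scalar Polynomial.X - 1) * ∑ l ∈ Finset.Icc 1 (m - 1), z ^ l : SeriesTX ℚ[X]) ∧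
      IsUnit (1 - t : SeriesTX ℚ) ∧ IsUnit (1 + t : SeriesTX ℚ) ∧
      IsUnit (1 - z ^ m : SeriesTX ℚ)) ∧
    -- (a), with s the variable of the ring of scalars
    (∃ F G : SeriesTX ℚ[X],
      HasFormalSumTX
        (fun n => evalAt (ilpkPoly (1 : Equiv.Perm (Fin m)) n) u * z ^ n) F ∧
      HasFormalSumTX
        (hadamardPow
          (frac z (1 - t) +
            frac ((scalar Polynomial.X - 1) * z ^ m)
              ((1 - t) *
                (1 - (scalar Polynomial.X - 1) * ∑ l ∈ Finset.Icc 1 (m - 1), z ^ l)))) G ∧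
      frac 1 (1 - t) * F = G) ∧
    -- (b) and (c)
    (∃ F G : SeriesTX ℚ, ∃ D : ℕ → ℚ⟦X⟧,
      HasFormalSumTX
        (fun n => evalAt (ilpkPolyAvoid (1 : Equiv.Perm (Fin m)) n) u * z ^ n) F ∧
      HasFormalSumTX
        (hadamardPow (frac (z * (1 - z ^ (m - 1))) ((1 - t) * (1 - z ^ m)))) G ∧
      frac 1 (1 - t) * F = G ∧
      (∀ k, HasFormalSumX
        (fun j => PowerSeries.C (dCoeff m j k : ℚ) * PowerSeries.X ^ (j * m) -
          PowerSeries.C (dCoeff' m j k : ℚ) * PowerSeries.X ^ (j * m + 1)) (D k)) ∧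
      (∀ k, IsUnit (D k)) ∧
      frac 1 (1 - t) * F = PowerSeries.mk fun k => frac 1 (D k)) := by
  refine ⟨⟨isUnit_one_sub_t, isUnit_one_add_t, isUnit_denominator_z _ m, isUnit_one_sub_t,
    isUnit_one_add_t, isUnit_one_sub_z_pow hm⟩, ?_, ?_⟩
  -- `G` is taken to be `frac 1 (1 - t) * F`; the content is that the Hadamard powers sum to it.
  · refine ⟨ilpkSeries Polynomial.X m, _, ?_, ?_, rfl⟩
    · simp only [evalAt_ilpkPoly]
      exact hasFormalSumTX_ilpkSeries _ m
    · rw [cluster_fraction_eq _ hm]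
      exact hasFormalSumTX_hadamardPow _ hm
  · have hunit : ∀ k, IsUnit (layerInverse (0 : ℚ) m k) := by
      intro k
      rw [PowerSeries.isUnit_iff_constantCoeff, constantCoeff_layerInverse _ hm]
      exact isUnit_one
    refine ⟨ilpkSeries 0 m, _, layerInverse 0 m, ?_, ?_, rfl,
      hasFormalSumX_layerInverse_zero hm, hunit, ?_⟩
    · simp only [evalAt_ilpkPolyAvoid]
      exact hasFormalSumTX_ilpkSeries _ m
    · rw [avoidance_fraction_eq hm]
      exact hasFormalSumTX_hadamardPow _ hm
    · refine PowerSeries.ext fun k => ?_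
      rw [PowerSeries.coeff_mk]
      exact (frac_eq_of_mul_eq (hunit k) (coeff_ilpkSeries_mul_layerInverse 0 hm k)).symm
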